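/- Let $[k]=\{1,\dots,k\}$. A set $A\subseteq[k]$ separates $B\subseteq[k]$ if $A\cap B\neq\emptyset$ and $A^c\cap B\neq\emptyset$. A collection $B_1,\dots,B_n\subseteq[k]$ is separable if $|B_i|\ge 2$ for all $i$ and some single set $A\subseteq[k]$ separates every $B_i$. A family $\mathcal F\subseteq\mathscr P([k])$ is $n$-separating if for every separable collection $B_1,\dots,B_n\subseteq[k]$ there is a single $A\in\mathcal F$ that separates every $B_i$. Theorem. The minimum size of an $n$-separating family on $[k]$ is $\Omega(2^n\log k)$. That is, there is an absolute constant $c>0$ such that for all integers $n\ge 1$ and $k\ge 2n$, the minimum size of an $n$-separating family on $[k]$ (equivalently, the size of every such family) is at least $c\,2^n\log_2 k$. -/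

import Mathlib

/-- `A` separates `B` when both `A ∩ B` and `Aᶜ ∩ B` are nonempty; the ground set is `Fin k`. -/
def Separates {k : ℕ} (A B : Finset (Fin k)) : Prop :=
  (A ∩ B).Nonempty ∧ (Aᶜ ∩ B).Nonempty

/-- A collection `B₁, …, Bₙ` (repetitions allowed) is separable when every `Bᵢ` has at least two
elements and a single set separates all of them. -/
def Separable {n k : ℕ} (B : Fin n → Finset (Fin k)) : Prop :=
  (∀ i, 2 ≤ (B i).card) ∧ ∃ A : Finset (Fin k), ∀ i, Separates A (B i)

/-- A family is `n`-separating when every separable collection of `n` sets is separated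
simultaneously by a single member of the family. -/
def IsNSeparating (n : ℕ) {k : ℕ} (F : Finset (Finset (Fin k))) : Prop :=
  ∀ B : Fin n → Finset (Fin k), Separable B → ∃ A ∈ F, ∀ i, Separates A (B i)

/-- The minimum size of an `n`-separating family on a set of size `k`. It is a true minimum, see
`exists_card_eq_minSepSize` and `minSepSize_le_card`. -/
noncomputable def minSepSize (n k : ℕ) : ℕ :=
  sInf {m : ℕ | ∃ F : Finset (Finset (Fin k)), IsNSeparating n F ∧ F.card = m}

theorem exists_card_eq_minSepSize (n k : ℕ) :
    ∃ F : Finset (Finset (Fin k)), IsNSeparating n F ∧ F.card = minSepSize n k := by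
  have h : {m : ℕ | ∃ F : Finset (Finset (Fin k)),
      IsNSeparating n F ∧ F.card = m}.Nonempty := by
    refine ⟨_, Finset.univ, ?_, rfl⟩
    intro B hB
    obtain ⟨A, hA⟩ := hB.2
    exact ⟨A, Finset.mem_univ A, hA⟩
  exact Nat.sInf_mem h

theorem minSepSize_le_card {n k : ℕ} (F : Finset (Finset (Fin k))) (hF : IsNSeparating n F) :
    minSepSize n k ≤ F.card :=
  Nat.sInf_le ⟨F, hF, rfl⟩

/-!
Regard `{x, y}` as an edge, cut by `A` when `A` separates it. Given a family `G` and a vertex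
set `V`, averaging over the cherries (paths with two edges) in `V` yields one whose two edges are
both cut by little more than a quarter of `G`: a set `A` that splits `V` into `a + b` vertices cuts
`a * b * (#V - 2)` of the `#V * (#V - 1) * (#V - 2)` cherries. Greedily removing `r` disjoint
cherries, `2 * r` edges in all, leaves at most `e * 4⁻ʳ * #F` members of the family `F`
that cut everything.

If `2 * r < n` and `F` is `n`-separating, one further edge is still free. It may be any pair of
unused vertices, so the surviving members of `F` distinguish all unused vertices, and their number
is at least the base-2 logarithm of the number of these.

Cherries are chosen instead of disjoint edges because they use 3 rather than 4 vertices for two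
edges: even for `k = 2 * n`, a positive proportion of the `k` vertices stays unused.
-/

section

open Finset

theorem exists_mul_card_filter_le {ι κ : Type*} (r : ι → κ → Prop) [∀ i j, Decidable (r i j)]
    {s : Finset ι} (hs : s.Nonempty) (t : Finset κ) {p q : ℕ}
    (h : ∀ j ∈ t, p * #{i ∈ s | r i j} ≤ q * #s) :
    ∃ i ∈ s, p * #{j ∈ t | r i j} ≤ q * #t := by
  refine exists_le_of_sum_le hs ?_
  calc ∑ i ∈ s, p * #{j ∈ t | r i j} = ∑ j ∈ t, p * #{i ∈ s | r i j} := by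
        simpa only [mul_sum, bipartiteAbove, bipartiteBelow] using
          congrArg (p * ·) (sum_card_bipartiteAbove_eq_sum_card_bipartiteBelow r)
    _ ≤ ∑ _j ∈ t, q * #s := sum_le_sum h
    _ = ∑ _i ∈ s, q * #t := by simp only [sum_const, smul_eq_mul]; ring

variable {α : Type*}

theorem card_le_two_pow_card_of_pairwise {W : Finset α} {H : Finset (Finset α)}
    (h : (W : Set α).Pairwise fun x y => ∃ A ∈ H, (x ∈ A ↔ y ∉ A)) : #W ≤ 2 ^ #H := by
  classical
  rw [← card_powerset]
  refine card_le_card_of_injOn (fun x => {A ∈ H | x ∈ A})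
    (fun x _ => mem_powerset.mpr (filter_subset _ _)) fun x hx y hy hxy => ?_
  by_contra hne
  obtain ⟨A, hA, hiff⟩ := h hx hy hne
  have hmem : x ∈ A ↔ y ∈ A := by simpa [hA] using congrArg (A ∈ ·) hxy
  tauto

/-- The vertex set `A` cuts the edge set `E` when every edge in `E` has exactly one end in `A`. An
edge is encoded as an ordered pair of its ends. -/
def Cuts (A : Finset α) (E : Finset (α × α)) : Prop :=
  ∀ e ∈ E, (e.1 ∈ A ↔ e.2 ∉ A)

/-- Every vertex set can be modified inside `U` so that it cuts `E`. For edges with both ends in `U`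
this is bipartiteness. -/
def CuttableWithin (U : Finset α) (E : Finset (α × α)) : Prop :=
  ∀ S : Finset α, ∃ A : Finset α, (∀ t ∉ U, t ∈ A ↔ t ∈ S) ∧ Cuts A E

theorem cuttableWithin_empty (U : Finset α) : CuttableWithin U ∅ :=
  fun S => ⟨S, by simp [Cuts]⟩

variable [DecidableEq α]

instance (A : Finset α) (E : Finset (α × α)) : Decidable (Cuts A E) :=
  inferInstanceAs (Decidable (∀ e ∈ E, (e.1 ∈ A ↔ e.2 ∉ A)))

theorem cuts_insert {A : Finset α} {e : α × α} {E : Finset (α × α)} :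
    Cuts A (insert e E) ↔ (e.1 ∈ A ↔ e.2 ∉ A) ∧ Cuts A E :=
  forall_mem_insert _ _ _

theorem cuts_union {A : Finset α} {D E : Finset (α × α)} :
    Cuts A (D ∪ E) ↔ Cuts A D ∧ Cuts A E :=
  forall_mem_union

theorem CuttableWithin.union {T U : Finset α} {D E : Finset (α × α)} (hD : CuttableWithin T D)
    (hE : CuttableWithin U E) (hDU : ∀ e ∈ D, e.1 ∉ U ∧ e.2 ∉ U) :
    CuttableWithin (T ∪ U) (D ∪ E) := by
  intro S
  obtain ⟨A, hAS, hAD⟩ := hD S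
  obtain ⟨A', hAA', hAE⟩ := hE A
  refine ⟨A', fun t ht => ?_, cuts_union.mpr ⟨fun e he => ?_, hAE⟩⟩
  · rw [mem_union, not_or] at ht
    rw [hAA' t ht.2, hAS t ht.1]
  · rw [hAA' _ (hDU e he).1, hAA' _ (hDU e he).2]
    exact hAD e he

/-- The edges of the cherry with centre `x` and leaves `y`, `z`. -/
def cherry (x y z : α) : Finset (α × α) :=
  {(x, y), (x, z)}

theorem cuts_cherry_iff {A : Finset α} {x y z : α} :
    Cuts A (cherry x y z) ↔ (x ∈ A ↔ y ∉ A) ∧ (x ∈ A ↔ z ∉ A) := by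
  simp [Cuts, cherry]

theorem cuttableWithin_cherry {x y z : α} (hxy : x ≠ y) (hxz : x ≠ z) :
    CuttableWithin {x, y, z} (cherry x y z) := by
  refine fun S => ⟨insert x S \ {y, z}, fun t ht => ?_, ?_⟩
  · simp only [mem_insert, mem_singleton, not_or] at ht
    simp [ht]
  · simp [cuts_cherry_iff, hxy, hxz]

/-- The cherries in `V`, each given by its centre and the ordered pair of its leaves. -/
def cherries (V : Finset α) : Finset (Σ _ : α, α × α) :=
  V.sigma fun x => (V.erase x).offDiag

theorem mem_cherries {V : Finset α} {x y z : α} :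
    ⟨x, y, z⟩ ∈ cherries V ↔ (x ∈ V ∧ y ∈ V ∧ z ∈ V) ∧ x ≠ y ∧ x ≠ z ∧ y ≠ z := by
  simp only [cherries, mem_sigma, mem_offDiag, mem_erase]
  tauto

theorem card_cherries (V : Finset α) : #(cherries V) = #V * ((#V - 1) * (#V - 2)) := by
  have hoffDiag : ∀ x ∈ V, #(V.erase x).offDiag = (#V - 1) * (#V - 2) := fun x hx => by
    rw [offDiag_card, card_erase_of_mem hx, ← Nat.mul_sub_one, Nat.sub_sub]
  rw [cherries, card_sigma, sum_congr rfl hoffDiag, sum_const, smul_eq_mul]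

theorem cherries_filter_cuts (V A : Finset α) :
    {c ∈ cherries V | Cuts A (cherry c.1 c.2.1 c.2.2)} =
      ((V ∩ A).sigma fun _ => (V \ A).offDiag) ∪ ((V \ A).sigma fun _ => (V ∩ A).offDiag) := by
  ext ⟨x, y, z⟩
  simp only [mem_filter, mem_cherries, cuts_cherry_iff, mem_union, mem_sigma, mem_offDiag,
    mem_inter, mem_sdiff]
  grind

theorem card_cherries_filter_cuts (V A : Finset α) :
    #{c ∈ cherries V | Cuts A (cherry c.1 c.2.1 c.2.2)} =
      #(V ∩ A) * #(V \ A) * (#V - 2) := by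
  have hdisj : Disjoint ((V ∩ A).sigma fun _ => (V \ A).offDiag)
      ((V \ A).sigma fun _ => (V ∩ A).offDiag) :=
    disjoint_left.mpr fun c hc hc' =>
      (mem_sdiff.mp (mem_sigma.mp hc').1).2 (mem_inter.mp (mem_sigma.mp hc).1).2
  rw [cherries_filter_cuts, card_union_of_disjoint hdisj, card_sigma, card_sigma, sum_const,
    sum_const, offDiag_card, offDiag_card, ← card_inter_add_card_sdiff V A, ← Nat.mul_sub_one,
    ← Nat.mul_sub_one, smul_eq_mul, smul_eq_mul]
  rcases Nat.eq_zero_or_pos #(V ∩ A) with ha | ha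
  · simp [ha]
  rcases Nat.eq_zero_or_pos #(V \ A) with hb | hb
  · simp [hb]
  zify [ha, hb, Nat.add_le_add ha hb]
  ring

theorem four_mul_card_cherries_filter_cuts_le (V A : Finset α) :
    4 * (#V - 1) * #{c ∈ cherries V | Cuts A (cherry c.1 c.2.1 c.2.2)} ≤
      #V * #(cherries V) := by
  have hcut : 4 * #(V ∩ A) * #(V \ A) ≤ #V ^ 2 :=
    card_inter_add_card_sdiff V A ▸ four_mul_le_sq_add _ _
  rw [card_cherries_filter_cuts, card_cherries]
  calc 4 * (#V - 1) * (#(V ∩ A) * #(V \ A) * (#V - 2))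
      = 4 * #(V ∩ A) * #(V \ A) * ((#V - 1) * (#V - 2)) := by ring
    _ ≤ #V ^ 2 * ((#V - 1) * (#V - 2)) := Nat.mul_le_mul_right _ hcut
    _ = #V * (#V * ((#V - 1) * (#V - 2))) := by ring

theorem exists_cherry_rarely_cut {s : ℕ} {V : Finset α} (hV : s + 3 ≤ #V)
    (G : Finset (Finset α)) :
    ∃ x y z, ⟨x, y, z⟩ ∈ cherries V ∧
      (#{A ∈ G | Cuts A (cherry x y z)} : ℝ) ≤ (1 + 1 / (s + 2)) / 4 * #G := by
  have hne : (cherries V).Nonempty := by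
    rw [← card_pos, card_cherries]
    exact Nat.mul_pos (by omega) (Nat.mul_pos (by omega) (by omega))
  obtain ⟨⟨x, y, z⟩, hc, hcut⟩ := exists_mul_card_filter_le (p := 4 * (#V - 1)) (q := #V)
    (fun c A => Cuts A (cherry c.1 c.2.1 c.2.2)) hne G
    fun A _ => four_mul_card_cherries_filter_cuts_le V A
  refine ⟨x, y, z, hc, ?_⟩
  obtain ⟨m, hm⟩ : ∃ m, #V = m + 1 := ⟨#V - 1, by omega⟩
  have hsm : (s : ℝ) + 2 ≤ m := by exact_mod_cast (by omega : s + 2 ≤ m)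
  have hm0 : (0 : ℝ) < m := lt_of_lt_of_le (by positivity) hsm
  have hcut' : 4 * (m : ℝ) * #{A ∈ G | Cuts A (cherry x y z)} ≤ (m + 1) * #G := by
    rw [hm, Nat.add_sub_cancel] at hcut
    exact_mod_cast hcut
  calc (#{A ∈ G | Cuts A (cherry x y z)} : ℝ) ≤ (m + 1) * #G / (4 * m) := by
        rwa [le_div_iff₀' (by positivity)]
    _ = (1 + 1 / m) / 4 * #G := by field_simp
    _ ≤ (1 + 1 / (s + 2)) / 4 * #G := by gcongr

theorem exists_cuttableWithin_rarely_cut {s r : ℕ} {V : Finset α} (hV : s + 3 * r ≤ #V)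
    (G : Finset (Finset α)) :
    ∃ U ⊆ V, #U = 3 * r ∧ ∃ E : Finset (α × α), #E ≤ 2 * r ∧ CuttableWithin U E ∧
      (#{A ∈ G | Cuts A E} : ℝ) ≤ ((1 + 1 / (s + 2)) / 4) ^ r * #G := by
  induction r generalizing V G with
  | zero => exact ⟨∅, empty_subset V, rfl, ∅, le_rfl, cuttableWithin_empty ∅, by simp [Cuts]⟩
  | succ r ih =>
    obtain ⟨x, y, z, hc, hxyz⟩ := exists_cherry_rarely_cut (s := s) (by omega : s + 3 ≤ #V) G
    obtain ⟨⟨hx, hy, hz⟩, hxy, hxz, hyz⟩ := mem_cherries.mp hc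
    have hTV : {x, y, z} ⊆ V := by simp [insert_subset_iff, hx, hy, hz]
    have hT : #{x, y, z} = 3 := card_eq_three.mpr ⟨x, y, z, hxy, hxz, hyz, rfl⟩
    obtain ⟨U, hUV, hU, E, hE, hUE, hcard⟩ := ih (V := V \ {x, y, z})
      (by rw [card_sdiff_of_subset hTV]; omega) {A ∈ G | Cuts A (cherry x y z)}
    have hTU : Disjoint {x, y, z} U := disjoint_sdiff.mono_right hUV
    refine ⟨{x, y, z} ∪ U, union_subset hTV (hUV.trans sdiff_subset), ?_, cherry x y z ∪ E, ?_,
      (cuttableWithin_cherry hxy hxz).union hUE ?_, ?_⟩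
    · rw [card_union_of_disjoint hTU]
      omega
    · have hcherry : #(cherry x y z) ≤ 2 := card_le_two
      exact (card_union_le _ _).trans (by omega)
    · simp only [disjoint_insert_left, disjoint_singleton_left] at hTU
      simp [cherry, hTU]
    · simp only [cuts_union, ← filter_filter]
      calc (#{A ∈ {A ∈ G | Cuts A (cherry x y z)} | Cuts A E} : ℝ)
          ≤ ((1 + 1 / (s + 2)) / 4) ^ r * #{A ∈ G | Cuts A (cherry x y z)} := hcard
        _ ≤ ((1 + 1 / (s + 2)) / 4) ^ r * ((1 + 1 / (s + 2)) / 4 * #G) := by gcongr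
        _ = ((1 + 1 / (s + 2)) / 4) ^ (r + 1) * #G := by ring

theorem Separates.two_le_card {k : ℕ} {A B : Finset (Fin k)} (h : Separates A B) : 2 ≤ #B := by
  obtain ⟨⟨a, ha⟩, b, hb⟩ := h
  rw [mem_inter] at ha
  rw [mem_inter, mem_compl] at hb
  exact one_lt_card.mpr ⟨a, ha.2, b, hb.2, ne_of_mem_of_not_mem ha.1 hb.1⟩

theorem separates_pair_iff {k : ℕ} {A : Finset (Fin k)} {x y : Fin k} :
    Separates A {x, y} ↔ (x ∈ A ↔ y ∉ A) := by
  simp only [Separates, Finset.Nonempty, mem_inter, mem_insert, mem_singleton, mem_compl]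
  grind

namespace IsNSeparating

variable {n k : ℕ} {F : Finset (Finset (Fin k))}

theorem exists_separates (hF : IsNSeparating n F) {P : Finset (Finset (Fin k))}
    (hP : P.Nonempty) (hPn : #P ≤ n) {A₀ : Finset (Fin k)} (hA₀ : ∀ B ∈ P, Separates A₀ B) :
    ∃ A ∈ F, ∀ B ∈ P, Separates A B := by
  have : Nonempty P := hP.to_subtype
  obtain ⟨f⟩ : Nonempty (P ↪ Fin n) := Function.Embedding.nonempty_of_card_le (by simpa using hPn)
  have hsurj : Function.Surjective (Function.invFun f) := Function.invFun_surjective f.injective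
  have hsep : ∀ i, Separates A₀ (Function.invFun f i : P) := fun i => hA₀ _ (Subtype.prop _)
  obtain ⟨A, hA, hAP⟩ := hF _ ⟨fun i => (hsep i).two_le_card, A₀, hsep⟩
  refine ⟨A, hA, fun B hB => ?_⟩
  obtain ⟨i, hi⟩ := hsurj ⟨B, hB⟩
  simpa only [hi] using hAP i

theorem exists_cuts (hF : IsNSeparating n F) {E : Finset (Fin k × Fin k)} (hE : E.Nonempty)
    (hEn : #E ≤ n) {A₀ : Finset (Fin k)} (hA₀ : Cuts A₀ E) : ∃ A ∈ F, Cuts A E := by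
  obtain ⟨A, hA, hAE⟩ := hF.exists_separates (P := E.image fun e => {e.1, e.2}) (hE.image _)
    (card_image_le.trans hEn) (A₀ := A₀)
    (forall_mem_image.mpr fun e he => separates_pair_iff.mpr (hA₀ e he))
  exact ⟨A, hA, fun e he => separates_pair_iff.mp (hAE _ (mem_image_of_mem _ he))⟩

theorem card_compl_le_two_pow (hF : IsNSeparating n F) {U : Finset (Fin k)}
    {E : Finset (Fin k × Fin k)} (hUE : CuttableWithin U E) (hEn : #E < n) :
    #Uᶜ ≤ 2 ^ #{A ∈ F | Cuts A E} := by
  refine card_le_two_pow_card_of_pairwise fun x hx y hy hxy => ?_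
  obtain ⟨A₀, hA₀, hcut⟩ := hUE {x}
  have hcut' : Cuts A₀ (insert (x, y) E) := by
    rw [mem_coe, mem_compl] at hx hy
    refine cuts_insert.mpr ⟨?_, hcut⟩
    simp [hA₀ x hx, hA₀ y hy, hxy.symm]
  obtain ⟨A, hA, hAE⟩ := hF.exists_cuts (insert_nonempty _ _)
    ((card_insert_le _ _).trans hEn) hcut'
  rw [cuts_insert] at hAE
  exact ⟨A, mem_filter.mpr ⟨hA, hAE.2⟩, hAE.1⟩

theorem four_pow_mul_logb_le (hF : IsNSeparating n F) {r s : ℕ} (hr : 2 * r < n) (hs : 0 < s)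
    (hk : s + 3 * r ≤ k) :
    4 ^ r * Real.logb 2 s ≤ (1 + 1 / ((s : ℝ) + 2)) ^ r * #F := by
  obtain ⟨U, -, hU, E, hE, hUE, hcard⟩ :=
    exists_cuttableWithin_rarely_cut (V := univ) (by simpa using hk) F
  have hpow : (s : ℝ) ≤ 2 ^ #{A ∈ F | Cuts A E} := by
    have hsU : s ≤ #Uᶜ := by
      rw [card_compl, Fintype.card_fin]
      omega
    exact_mod_cast hsU.trans (hF.card_compl_le_two_pow hUE (hE.trans_lt hr))
  have hlog : Real.logb 2 s ≤ #{A ∈ F | Cuts A E} := by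
    rwa [Real.logb_le_iff_le_rpow one_lt_two (by positivity), Real.rpow_natCast]
  calc 4 ^ r * Real.logb 2 s ≤ 4 ^ r * (((1 + 1 / (s + 2)) / 4) ^ r * #F) := by
        gcongr
        exact hlog.trans hcard
    _ = (1 + 1 / ((s : ℝ) + 2)) ^ r * #F := by
        rw [div_pow]
        field_simp

end IsNSeparating

theorem one_add_inv_pow_le_three {r m : ℕ} (hr : r ≤ m) : (1 + (m : ℝ)⁻¹) ^ r ≤ 3 :=
  calc (1 + (m : ℝ)⁻¹) ^ r ≤ (1 + (m : ℝ)⁻¹) ^ m :=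
        pow_le_pow_right₀ (le_add_of_nonneg_right (by positivity)) hr
    _ ≤ Real.exp 1 := Real.one_add_inv_pow_le_exp
    _ ≤ 3 := Real.exp_one_lt_three.le

theorem IsNSeparating.two_pow_mul_logb_le {n k : ℕ} {F : Finset (Finset (Fin k))}
    (hF : IsNSeparating n F) (hn : 1 ≤ n) (hk : 2 * n ≤ k) :
    2 ^ n * Real.logb 2 k ≤ 24 * (#F : ℝ) := by
  obtain ⟨r, hr⟩ : ∃ r, r = (n - 1) / 2 := ⟨_, rfl⟩
  obtain ⟨s, hs⟩ : ∃ s, k = s + 3 * r := ⟨k - 3 * r, by omega⟩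
  have hlog : Real.logb 2 k ≤ 2 * Real.logb 2 s := by
    have hks : (k : ℝ) ≤ s ^ 2 := by
      have hks4 : (k : ℝ) + 4 ≤ 4 * s := by exact_mod_cast (by omega : k + 4 ≤ 4 * s)
      linarith [sq_nonneg ((s : ℝ) - 2)]
    calc Real.logb 2 k ≤ Real.logb 2 ((s : ℝ) ^ 2) :=
          Real.logb_le_logb_of_le one_lt_two (by norm_cast; omega) hks
      _ = 2 * Real.logb 2 s := by rw [Real.logb_pow, Nat.cast_ofNat]
  have hpow : (2 : ℝ) ^ n ≤ 4 * 4 ^ r :=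
    calc (2 : ℝ) ^ n ≤ 2 ^ (2 * r + 2) := pow_le_pow_right₀ one_le_two (by omega)
      _ = 4 * 4 ^ r := by rw [pow_add, pow_mul]; norm_num; ring
  have hfactor : (1 + 1 / ((s : ℝ) + 2)) ^ r ≤ 3 := by
    simpa using one_add_inv_pow_le_three (by omega : r ≤ s + 2)
  have hlog0 : 0 ≤ Real.logb 2 (k : ℝ) :=
    Real.logb_nonneg one_lt_two (by exact_mod_cast (by omega : 1 ≤ k))
  calc 2 ^ n * Real.logb 2 k ≤ 4 * 4 ^ r * (2 * Real.logb 2 s) := by gcongr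
    _ = 8 * (4 ^ r * Real.logb 2 s) := by ring
    _ ≤ 8 * ((1 + 1 / ((s : ℝ) + 2)) ^ r * #F) :=
        mul_le_mul_of_nonneg_left (hF.four_pow_mul_logb_le (by omega) (by omega) hs.ge)
          (by norm_num)
    _ ≤ 8 * (3 * #F) := by gcongr
    _ = 24 * (#F : ℝ) := by ring

end

theorem mainTheorem2 :
    ∃ c : ℝ, 0 < c ∧ ∀ n k : ℕ, 1 ≤ n → 2 * n ≤ k →
      c * (2 ^ n * Real.logb 2 (k : ℝ)) ≤ (minSepSize n k : ℝ) := by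
  refine ⟨1 / 24, by norm_num, fun n k hn hk => ?_⟩
  obtain ⟨F, hF, hcard⟩ := exists_card_eq_minSepSize n k
  rw [← hcard]
  linarith [hF.two_pow_mul_logb_le hn hk]
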